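/- Let $T>0$ and $H\in(0,1)$, and let $$k_H(t,\tau)=\frac{a_H}{\Gamma(H+1/2)}\,(t-\tau)^{H-1/2}\,{}_2F_1\Bigl(\tfrac12-H,\,H-\tfrac12;\,H+\tfrac12;\,1-\tfrac t\tau\Bigr)\,1(t-\tau),\qquad a_H=\sqrt{\frac{2H\,\Gamma(H+1/2)\,\Gamma(3/2-H)}{\Gamma(2-2H)}},$$ be the Decreusefond–Üstünel kernel, where ${}_2F_1$ is the (analytically continued) hypergeometric function, and $1(\eta)=1$ for $\eta>0$, $1(\eta)=0$ for $\eta\le 0$. Let $$\hat P(i,t)=\sqrt{\tfrac{2i+1}{T}}\sum_{k=0}^i l_{ik}\frac{t^k}{T^k},\qquad l_{ik}=(-1)^{i-k}\binom{i+k}{i}\binom{i}{i-k},$$ be the orthonormal Legendre polynomials on $[0,T]$, let $x^{\overline{k}}=x(x+1)\cdots(x+k-1)$ and $x^{\underline{k}}=x(x-1)\cdots(x-k+1)$, and let $F^\alpha$ be the infinite column with elements $F_i^\alpha=\int_0^T t^\alpha\hat P(i,t)\,dt$, $i=0,1,2,\dots$ Then the integrals $$K_{ij}^H=\int_{[0,T]^2}\hat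 P(i,t)\,\hat P(j,\tau)\,k_H(t,\tau)\,dt\,d\tau,\qquad i,j=0,1,2,\dots,$$ converge absolutely, and the $j$th column of the infinite matrix $K^H=(K_{ij}^H)$ is $$K_{*j}^H=a_H\,\Gamma(3/2-H)\sqrt{\frac{2j+1}{T}}\sum_{k=0}^j\frac{l_{jk}\,(3/2-H)^{\overline{k}}}{T^k\,(H+1/2+k)\,k!}\,F^{H+1/2+k},\qquad j=0,1,2,\dots$$ Here, for every $\alpha=H+1/2+k$ with $k=0,1,2,\dots$ and every $i=0,1,2,\dots$, the integral $F_i^\alpha$ converges absolutely and $$F_i^\alpha=\sqrt{\frac{2i+1}{T}}\sum_{m=0}^i l_{im}\frac{T^{\alpha+1}}{\alpha+m+1}=T^\alpha\sqrt T\,\frac{\sqrt{2i+1}\;\alpha^{\underline{i}}}{(\alpha+1)^{\overline{i+1}}},\qquad F_{i+1}^\alpha=\sqrt{\frac{2i+3}{2i+1}}\,\frac{\alpha-i}{\alpha+i+2}\,F_i^\alpha .$$ If $H\ne1/2$, then moreover, with $\alpha=H+1/2$, $$F_i^{\alpha+k}=\frac{T^k\,[(\alpha+1)^{\overline{k}}]^2}{(\alpha-i+1)^{\overline{k}}\,(\alpha+i+2)^{\overline{k}}}\,F_i^{\alpha},\qquad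 i,k=0,1,2,\dots,$$ and for all $i,j=0,1,2,\dots$ $$K_{ij}^H=a_H\,\Gamma(1/2-H)\sqrt{\frac{2j+1}{T}}\,F_i^{H+1/2}\sum_{k=0}^j(-1)^{j-k}\,\frac{1/2-H+k}{H+1/2+k}\,\Pi_k^{(ij)},$$ where $\Pi_0^{(ij)}=1$ and, for $k=1,2,\dots$, $$\Pi_k^{(ij)}=\frac{(H+1/2+k)^2\,(k-1/2-H)}{k^3}\,\frac{j-k+1}{H+1/2-i+k}\,\frac{j+k}{H+1/2+i+k+1}\,\Pi_{k-1}^{(ij)}.$$ -/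

import Mathlib

open MeasureTheory Finset

noncomputable section

/-- The real Gauss hypergeometric function `₂F₁(a, b; c; x)` on `(-∞, 1)`: the analytic continuation
to `(-∞, 1)` of the sum of the hypergeometric series on `(-1, 1)`. (The continuation is unique, as
`(-∞, 1)` is connected; the value for `x ≥ 1` is set to `0` and plays no role.) -/
def gaussHyp (a b c x : ℝ) : ℝ :=
  open Classical in
  if h : x < 1 ∧ ∃ f : ℝ → ℝ, AnalyticOnNhd ℝ f (Set.Iio 1) ∧
      ∀ y : ℝ, |y| < 1 → f y = ordinaryHypergeometric a b c y
  then h.2.choose x else 0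

/-- The constant `a_H = √(2 H Γ(H + 1/2) Γ(3/2 - H) / Γ(2 - 2H))`. -/
def fbmConst (H : ℝ) : ℝ :=
  Real.sqrt (2 * H * Real.Gamma (H + 1 / 2) * Real.Gamma (3 / 2 - H) / Real.Gamma (2 - 2 * H))

/-- The Decreusefond–Üstünel kernel
`k_H(t, τ) = (a_H / Γ(H + 1/2)) (t - τ)^(H - 1/2) ₂F₁(1/2 - H, H - 1/2; H + 1/2; 1 - t/τ) 1(t - τ)`
of the representation `B_H(t) = ∫₀ᵗ k_H(t, τ) dB(τ)` of fractional Brownian motion. The factor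
`1 / Γ(H + 1/2)` is the normalisation for which `∫₀ᵀ k_H(t, θ) k_H(τ, θ) dθ` is the covariance
`(t^(2H) + τ^(2H) - |t - τ|^(2H)) / 2`. -/
def fbmKernel (H t τ : ℝ) : ℝ :=
  if 0 < t - τ then
    fbmConst H / Real.Gamma (H + 1 / 2) * (t - τ) ^ (H - 1 / 2) *
      gaussHyp (1 / 2 - H) (H - 1 / 2) (H + 1 / 2) (1 - t / τ)
  else 0

/-- `l_{ik} = (-1)^(i-k) C(i+k, i) C(i, i-k)`, for `k ≤ i`. -/
def legendreCoeff (i k : ℕ) : ℝ :=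
  (-1) ^ (i - k) * ((i + k).choose i : ℝ) * (i.choose (i - k) : ℝ)

/-- The orthonormal Legendre polynomial `P̂(i, t)` on `[0, T]`. -/
def legendreHat (T : ℝ) (i : ℕ) (t : ℝ) : ℝ :=
  Real.sqrt ((2 * i + 1) / T) * ∑ k ∈ range (i + 1), legendreCoeff i k * (t ^ k / T ^ k)

/-- The infinite column `F^α` of the Legendre coefficients of `t ↦ t^α` on `[0, T]`. -/
def powerCoeff (T α : ℝ) : ℕ → ℝ :=
  fun i => ∫ t in Set.Icc 0 T, t ^ α * legendreHat T i t

/-- The infinite matrix `K^H` of the Legendre coefficients of `k_H` on `[0, T]²`. -/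
def fbmMatrix (T H : ℝ) : Matrix ℕ ℕ ℝ :=
  fun i j => ∫ p in Set.Icc 0 T ×ˢ Set.Icc 0 T,
    legendreHat T i p.1 * legendreHat T j p.2 * fbmKernel H p.1 p.2

/-- The recursive product `Π_k^{(ij)}`. -/
def fbmProd (H : ℝ) (i j : ℕ) : ℕ → ℝ
  | 0 => 1
  | n + 1 =>
    let k : ℝ := n + 1
    (H + 1 / 2 + k) ^ 2 * (k - 1 / 2 - H) / k ^ 3 * ((j - k + 1) / (H + 1 / 2 - i + k)) *
      ((j + k) / (H + 1 / 2 + i + k + 1)) * fbmProd H i j n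

/-- The upper factorial `x (x + 1) ⋯ (x + k - 1)`. -/
def upperFactorial (x : ℝ) (k : ℕ) : ℝ := (ascPochhammer ℝ k).eval x

/-- The lower factorial `x (x - 1) ⋯ (x - k + 1)`. -/
def lowerFactorial (x : ℝ) (k : ℕ) : ℝ := (descPochhammer ℝ k).eval x

end

open scoped Topology

/-! ### Rising and falling factorials -/

/-! With `a = 1/2 - H`, so that `|a| < 1/2`, the kernel contains ₂F₁(a, -a; 1-a; x) at x = 1 - t/τ,
which leaves the disc of convergence when t ≥ 2τ. The Pfaff transformation turns this function into
(1-x)^(-a) G(x/(x-1)), where G = ₂F₁(a, 1; 1-a; ·) and x/(x-1) = 1 - τ/t lies in (0,1). Hence k_H is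
homogeneous: a constant times t^(H-1/2) ψ(τ/t) (`fbmKernel_eq_profile`). Pfaff itself holds because
both sides are analytic at 0 with value 1 and solve the first-order equation x y' - a y = -a
(1-x)^(-a) (`hypergeometric_ode`, `pfaff_ode`).

By homogeneity, integrating τ^k against the kernel yields t^(H+1/2+k) times the k-th moment of ψ.
Termwise Beta integrals reduce this moment to ∑ (a)ₙ/(k+n+1)!, which telescopes
(`hasSum_upperFactorial_div_factorial`, `integral_pow_mul_kernelProfile`). Expanding P̂(j, ·) in
powers and applying Fubini gives the columns of K^H.

The closed form of F^α follows from a recurrence in i, itself a consequence of the ratio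
l_{i+1,m}/l_{i,m} and of the normalisation P_i(1) = 1 (`sum_legendreCoeff_div_succ`). The closed
form gives the step α → α+1, and substituting it into the columns produces Π, whose closed form is
`fbmProd_eq`. -/

theorem upperFactorial_zero (x : ℝ) : upperFactorial x 0 = 1 := by simp [upperFactorial]

theorem upperFactorial_succ (x : ℝ) (n : ℕ) :
    upperFactorial x (n + 1) = upperFactorial x n * (x + n) := by
  simp [upperFactorial, ascPochhammer_succ_eval]

theorem upperFactorial_pos {x : ℝ} (hx : 0 < x) (n : ℕ) : 0 < upperFactorial x n :=
  ascPochhammer_pos n x hx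

theorem Gamma_add_natCast {x : ℝ} (hx : 0 < x) (n : ℕ) :
    Real.Gamma (x + n) = upperFactorial x n * Real.Gamma x := by
  induction n with
  | zero => simp [upperFactorial_zero]
  | succ n ih =>
    rw [upperFactorial_succ, Nat.cast_succ, ← add_assoc, Real.Gamma_add_one (by positivity), ih]
    ring

theorem upperFactorial_neg_mul (a : ℝ) (n : ℕ) :
    upperFactorial (-a) n * (n - a) = -a * upperFactorial (1 - a) n := by
  induction n with
  | zero => simp [upperFactorial_zero]
  | succ n ih =>
    rw [upperFactorial_succ, upperFactorial_succ]
    push_cast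
    linear_combination (1 - a + n) * ih

/-! ### Power series with bounded coefficients -/

section PowerSeries

variable {c : ℕ → ℝ}

theorem summable_mul_pow_of_abs_le_one (hc : ∀ n, |c n| ≤ 1) {x : ℝ} (hx : |x| < 1) :
    Summable fun n => c n * x ^ n := by
  refine .of_norm_bounded (summable_geometric_of_lt_one (abs_nonneg x) hx) fun n => ?_
  rw [norm_mul, norm_pow, Real.norm_eq_abs, Real.norm_eq_abs]
  exact mul_le_of_le_one_left (by positivity) (hc n)

theorem hasFPowerSeriesOnBall_tsum_mul_pow (hc : ∀ n, |c n| ≤ 1) :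
    HasFPowerSeriesOnBall (fun x : ℝ => ∑' n, c n * x ^ n)
      (FormalMultilinearSeries.ofScalars ℝ c) 0 1 where
  r_le := by
    refine ENNReal.le_of_forall_nnreal_lt fun r hr => ?_
    refine FormalMultilinearSeries.le_radius_of_bound _ 1 fun n => ?_
    rw [FormalMultilinearSeries.ofScalars_norm]
    have hr1 : (r : ℝ) ≤ 1 := by exact_mod_cast hr.le
    exact mul_le_one₀ (hc n) (by positivity) (pow_le_one₀ (by positivity) hr1)
  r_pos := one_pos
  hasSum := by
    intro y hy
    have hy1 : |y| < 1 := by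
      simpa [enorm_eq_nnnorm, ← NNReal.coe_lt_coe] using hy
    simp only [FormalMultilinearSeries.ofScalars_apply_eq, zero_add, smul_eq_mul]
    exact (summable_mul_pow_of_abs_le_one hc hy1).hasSum

theorem analyticOnNhd_tsum_mul_pow (hc : ∀ n, |c n| ≤ 1) :
    AnalyticOnNhd ℝ (fun x : ℝ => ∑' n, c n * x ^ n) {x : ℝ | |x| < 1} := by
  intro x hx
  refine (hasFPowerSeriesOnBall_tsum_mul_pow hc).analyticAt_of_mem ?_
  simpa [enorm_eq_nnnorm, ← NNReal.coe_lt_coe] using hx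

/-- Expressing the termwise derivative through x·D keeps the exponent n, so that differential
equations become coefficient identities. -/
theorem exists_hasDerivAt_tsum_mul_pow (hc : ∀ n, |c n| ≤ 1) {x : ℝ} (hx : |x| < 1) :
    ∃ D, HasDerivAt (fun x : ℝ => ∑' n, c n * x ^ n) D x ∧
      HasSum (fun n => n * c n * x ^ n) (x * D) := by
  obtain ⟨r, hxr, hr⟩ := exists_between hx
  have hr0 : 0 < r := (abs_nonneg x).trans_lt hxr
  have hu : Summable fun n : ℕ => (n : ℝ) * r ^ (n - 1) := by
    refine (summable_nat_add_iff 1).1 ?_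
    have h := (summable_pow_mul_geometric_of_norm_lt_one 1 (r := r)
      (by rwa [Real.norm_of_nonneg hr0.le])).add
      (summable_geometric_of_lt_one hr0.le hr)
    refine h.congr fun n => ?_
    push_cast
    simp
    ring
  have hbd : ∀ (n : ℕ) (y : ℝ), y ∈ Metric.ball (0 : ℝ) r →
      ‖c n * (n * y ^ (n - 1))‖ ≤ n * r ^ (n - 1) := by
    intro n y hy
    have hy : |y| ≤ r := by simpa using (Metric.mem_ball.1 hy).le
    rw [norm_mul, norm_mul, norm_pow, Real.norm_eq_abs, Real.norm_eq_abs y, Real.norm_natCast]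
    refine (mul_le_of_le_one_left (by positivity) (hc n)).trans ?_
    gcongr
  have hxm : x ∈ Metric.ball (0 : ℝ) r := by simpa using hxr
  refine ⟨∑' n, c n * (n * x ^ (n - 1)), ?_, ?_⟩
  · exact hasDerivAt_tsum_of_isPreconnected (g := fun n x => c n * x ^ n) hu Metric.isOpen_ball
      (convex_ball 0 r).isPreconnected (fun n y _ => (hasDerivAt_pow n y).const_mul (c n)) hbd
      (y₀ := x) hxm (summable_mul_pow_of_abs_le_one hc hx) hxm
  · have hs : Summable fun n : ℕ => c n * (n * x ^ (n - 1)) :=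
      .of_norm_bounded hu fun n => hbd n x hxm
    refine (hs.hasSum.mul_left x).congr_fun ?_
    intro n
    cases n with
    | zero => simp
    | succ n => simp only [Nat.add_sub_cancel]; ring

end PowerSeries

/-! ### An Euler-type differential equation -/

/-- A nonzero analytic solution of x d' = a d is xⁿ e(x) with e(0) ≠ 0, and comparing leading
coefficients forces n = a. But n ≥ 1 since d vanishes at 0, while a < 1. -/
theorem AnalyticAt.eventually_eq_zero_of_mul_deriv_eq {d : ℝ → ℝ} {a : ℝ} (ha : a < 1)
    (hd : AnalyticAt ℝ d 0) (h0 : d 0 = 0) (hode : ∀ᶠ x in 𝓝 0, x * deriv d x = a * d x) :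
    ∀ᶠ x in 𝓝 0, d x = 0 := by
  by_contra hne
  obtain ⟨n, e, he, he0, hde⟩ := hd.exists_eventuallyEq_pow_smul_nonzero_iff.2 hne
  simp only [sub_zero, smul_eq_mul] at hde
  have hn : n ≠ 0 := by
    rintro rfl
    have := hde.self_of_nhds
    simp_all
  have hev : ∀ᶠ x in 𝓝[≠] (0 : ℝ), n * e x + x * deriv e x = a * e x := by
    have h1 := eventually_nhdsWithin_of_eventually_nhds (s := {0}ᶜ) hde.eventually_nhds
    have h2 := eventually_nhdsWithin_of_eventually_nhds (s := {0}ᶜ) hode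
    have h3 := eventually_nhdsWithin_of_eventually_nhds (s := {0}ᶜ) he.eventually_analyticAt
    filter_upwards [h1, h2, h3, self_mem_nhdsWithin] with x hx1 hx2 hx3 hx
    have hx : x ≠ 0 := hx
    have hder : deriv d x = n * x ^ (n - 1) * e x + x ^ n * deriv e x := by
      rw [Filter.EventuallyEq.deriv_eq (f := fun x => x ^ n * e x) hx1]
      exact ((hasDerivAt_pow n x).mul hx3.differentiableAt.hasDerivAt).deriv
    rw [hder, hx1.self_of_nhds] at hx2
    have hp : x * x ^ (n - 1) = x ^ n := by
      rw [← pow_succ', Nat.sub_add_cancel (Nat.pos_of_ne_zero hn)]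
    have hxn : x ^ n ≠ 0 := pow_ne_zero _ hx
    apply mul_left_cancel₀ hxn
    linear_combination hx2 - n * e x * hp
  -- Dividing by xⁿ was possible only off 0; the limit x → 0 now gives n e(0) = a e(0).
  have hL : Filter.Tendsto (fun x => n * e x + x * deriv e x) (𝓝[≠] 0)
      (𝓝 (n * e 0 + 0 * deriv e 0)) :=
    ((continuousAt_const.mul he.continuousAt).add
      (continuousAt_id.mul he.deriv.continuousAt)).tendsto.mono_left nhdsWithin_le_nhds
  have hR : Filter.Tendsto (fun x => a * e x) (𝓝[≠] 0) (𝓝 (a * e 0)) :=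
    (continuousAt_const.mul he.continuousAt).tendsto.mono_left nhdsWithin_le_nhds
  have := tendsto_nhds_unique (hL.congr' hev) hR
  have hna : (n : ℝ) = a := mul_right_cancel₀ he0 (by linarith)
  have : (1 : ℝ) ≤ n := by exact_mod_cast Nat.pos_of_ne_zero hn
  linarith

/-! ### The Pfaff transformation of `₂F₁(a, -a; 1 - a; x)` -/

/-- The function `₂F₁(a, 1; 1 - a; x) = ∑ (a)ₙ / (1 - a)ₙ xⁿ`. -/
noncomputable def pochRatioSeries (a x : ℝ) : ℝ :=
  ∑' n, upperFactorial a n / upperFactorial (1 - a) n * x ^ n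

theorem abs_upperFactorial_div_le_one {a : ℝ} (ha : |a| < 1 / 2) (n : ℕ) :
    |upperFactorial a n / upperFactorial (1 - a) n| ≤ 1 := by
  obtain ⟨h1, h2⟩ := abs_lt.1 ha
  induction n with
  | zero => simp [upperFactorial_zero]
  | succ n ih =>
    rw [upperFactorial_succ, upperFactorial_succ, mul_div_mul_comm, abs_mul]
    have hn : (0 : ℝ) ≤ n := n.cast_nonneg
    refine mul_le_one₀ ih (abs_nonneg _) ?_
    rw [abs_div, abs_of_pos (a := 1 - a + n) (by linarith), div_le_one (by linarith), abs_le]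
    constructor <;> linarith

theorem abs_hypergeometric_coeff_le_one {a : ℝ} (ha : |a| < 1 / 2) (n : ℕ) :
    |(n.factorial : ℝ)⁻¹ * upperFactorial a n * upperFactorial (-a) n *
      (upperFactorial (1 - a) n)⁻¹| ≤ 1 := by
  obtain ⟨h1, h2⟩ := abs_lt.1 ha
  induction n with
  | zero => simp [upperFactorial_zero]
  | succ n ih =>
    have hn : (0 : ℝ) ≤ n := n.cast_nonneg
    rw [upperFactorial_succ, upperFactorial_succ, upperFactorial_succ, Nat.factorial_succ,
      Nat.cast_mul, Nat.cast_succ]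
    have : (((n : ℝ) + 1) * n.factorial)⁻¹ * (upperFactorial a n * (a + n)) *
        (upperFactorial (-a) n * (-a + n)) * (upperFactorial (1 - a) n * (1 - a + n))⁻¹ =
        ((n.factorial : ℝ)⁻¹ * upperFactorial a n * upperFactorial (-a) n *
      (upperFactorial (1 - a) n)⁻¹) * (((a + n) / (n + 1)) * ((-a + n) / (1 - a + n))) := by
      simp only [mul_inv, div_eq_mul_inv]; ring
    rw [this, abs_mul, abs_mul ((a + n) / (n + 1))]
    refine mul_le_one₀ ih (by positivity) (mul_le_one₀ ?_ (by positivity) ?_)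
    · rw [abs_div, abs_of_pos (a := (n : ℝ) + 1) (by linarith), div_le_one (by linarith), abs_le]
      constructor <;> linarith
    · rw [abs_div, abs_of_pos (a := 1 - a + n) (by linarith), div_le_one (by linarith), abs_le]
      constructor <;> linarith

theorem pochRatioSeries_ode {a : ℝ} (ha : |a| < 1 / 2) {z : ℝ} (hz : |z| < 1) :
    ∃ D, HasDerivAt (pochRatioSeries a) D z ∧
      z * (1 - z) * D = a * (1 + z) * pochRatioSeries a z - a := by
  obtain ⟨h1, h2⟩ := abs_lt.1 ha
  have hb := abs_upperFactorial_div_le_one ha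
  obtain ⟨D, hD, hS⟩ := exists_hasDerivAt_tsum_mul_pow hb hz
  refine ⟨D, hD, ?_⟩
  have hG : HasSum (fun n => upperFactorial a n / upperFactorial (1 - a) n * z ^ n)
      (pochRatioSeries a z) := (summable_mul_pow_of_abs_le_one hb hz).hasSum
  -- Removing the term -a at n = 0 from ∑ (n - a) cₙ zⁿ shifts the index; the ratio cₙ₊₁ (n + 1 - a)
  -- = cₙ (n + a) identifies the rest with z (a G + z G').
  have hA := (hasSum_nat_add_iff' 1).2 (hS.sub (hG.mul_left a))
  have hB := ((hG.mul_left a).add hS).mul_left z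
  have hAB := hA.unique (hB.congr_fun ?_)
  · simp [upperFactorial_zero] at hAB
    linear_combination hAB
  · intro n
    have hp : upperFactorial (1 - a) n ≠ 0 := (upperFactorial_pos (by linarith) n).ne'
    have hn : 1 - a + n ≠ 0 := by linarith [(n.cast_nonneg : (0 : ℝ) ≤ n)]
    rw [upperFactorial_succ, upperFactorial_succ, pow_succ]
    push_cast
    field_simp
    ring

theorem hasSum_one_sub_rpow (a : ℝ) {x : ℝ} (hx : |x| < 1) :
    HasSum (fun n : ℕ => upperFactorial a n / n.factorial * x ^ n) ((1 - x) ^ (-a)) := by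
  have h := (Real.one_div_one_sub_rpow_hasFPowerSeriesOnBall_zero a).hasSum
    (y := x) (by simpa [enorm_eq_nnnorm, ← NNReal.coe_lt_coe] using hx)
  obtain ⟨h1, h2⟩ := abs_lt.1 hx
  simp only [FormalMultilinearSeries.ofScalars_apply_eq, zero_add, smul_eq_mul] at h
  rw [Real.rpow_neg (by linarith), ← one_div]
  refine h.congr_fun ?_
  intro n
  congr 1
  rw [Ring.choose, show a + n - 1 - n + 1 = a by ring]
  have := Ring.factorial_nsmul_multichoose_eq_ascPochhammer a n
  rw [Polynomial.ascPochhammer_smeval_eq_eval, nsmul_eq_mul] at this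
  rw [upperFactorial, ← this, mul_div_cancel_left₀ _ (by positivity)]

/-- Applying x d/dx - a multiplies the n-th coefficient by n - a, and (-a)ₙ (n - a) = -a (1-a)ₙ
cancels the denominator, which leaves the binomial series. -/
theorem hypergeometric_ode {a : ℝ} (ha : |a| < 1 / 2) {x : ℝ} (hx : |x| < 1) :
    ∃ D, HasDerivAt (ordinaryHypergeometric a (-a) (1 - a)) D x ∧
      x * D - a * ordinaryHypergeometric a (-a) (1 - a) x = -a * (1 - x) ^ (-a) := by
  obtain ⟨h1, h2⟩ := abs_lt.1 ha
  have hb := abs_hypergeometric_coeff_le_one ha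
  obtain ⟨D, hD, hS⟩ := exists_hasDerivAt_tsum_mul_pow hb hx
  have hF : HasSum (fun n => (n.factorial : ℝ)⁻¹ * upperFactorial a n * upperFactorial (-a) n *
      (upperFactorial (1 - a) n)⁻¹ * x ^ n) (ordinaryHypergeometric a (-a) (1 - a) x) := by
    rw [ordinaryHypergeometric_eq_tsum]
    exact (summable_mul_pow_of_abs_le_one hb hx).hasSum
  refine ⟨D, by rw [ordinaryHypergeometric_eq_tsum]; exact hD, ?_⟩
  refine (hS.sub (hF.mul_left a)).unique
    (((hasSum_one_sub_rpow a hx).mul_left (-a)).congr_fun ?_)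
  intro n
  have hp : upperFactorial (1 - a) n ≠ 0 := (upperFactorial_pos (by linarith) n).ne'
  have := upperFactorial_neg_mul a n
  field_simp
  linear_combination upperFactorial a n * x ^ n * this

theorem analyticOnNhd_hypergeometric {a : ℝ} (ha : |a| < 1 / 2) :
    AnalyticOnNhd ℝ (ordinaryHypergeometric a (-a) (1 - a)) {x : ℝ | |x| < 1} := by
  rw [ordinaryHypergeometric_eq_tsum]
  exact analyticOnNhd_tsum_mul_pow (abs_hypergeometric_coeff_le_one ha)

theorem abs_div_sub_one_lt_one {x : ℝ} (hx : x < 1 / 2) : |x / (x - 1)| < 1 := by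
  rw [abs_div, div_lt_one (abs_pos.2 (by linarith)), abs_of_neg (a := x - 1) (by linarith), abs_lt]
  constructor <;> linarith

theorem analyticOnNhd_pfaff {a : ℝ} (ha : |a| < 1 / 2) :
    AnalyticOnNhd ℝ (fun x => (1 - x) ^ (-a) * pochRatioSeries a (x / (x - 1)))
      (Set.Iio (1 / 2)) := by
  intro x hx
  have hx : x < 1 / 2 := hx
  have h1 : AnalyticAt ℝ (fun x : ℝ => (1 - x) ^ (-a)) x :=
    AnalyticAt.fun_comp (g := fun y : ℝ => y ^ (-a)) 
      (Real.contDiffAt_rpow_const_of_ne (by linarith)).analyticAt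
      (by fun_prop)
  have h2 : AnalyticAt ℝ (fun x : ℝ => x / (x - 1)) x :=
    AnalyticAt.fun_div (by fun_prop) (by fun_prop) (by linarith)
  have h3 : AnalyticAt ℝ (pochRatioSeries a) (x / (x - 1)) :=
    analyticOnNhd_tsum_mul_pow (abs_upperFactorial_div_le_one ha) _ (abs_div_sub_one_lt_one hx)
  exact h1.mul (AnalyticAt.fun_comp (g := pochRatioSeries a) h3 h2)

theorem pfaff_ode {a : ℝ} (ha : |a| < 1 / 2) {x : ℝ} (hx : x < 1 / 2) :
    ∃ D, HasDerivAt (fun x => (1 - x) ^ (-a) * pochRatioSeries a (x / (x - 1))) D x ∧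
      x * D - a * ((1 - x) ^ (-a) * pochRatioSeries a (x / (x - 1))) = -a * (1 - x) ^ (-a) := by
  obtain ⟨D, hD, hode⟩ := pochRatioSeries_ode ha (abs_div_sub_one_lt_one hx)
  have hx1 : 0 < 1 - x := by linarith
  have hx1' : x - 1 ≠ 0 := by linarith
  have h1 : HasDerivAt (fun x : ℝ => (1 - x) ^ (-a)) (a * (1 - x) ^ (-a) / (1 - x)) x := by
    refine (((hasDerivAt_id x).const_sub 1).rpow_const (p := -a) (Or.inl hx1.ne')).congr_deriv ?_
    rw [id_eq, Real.rpow_sub_one hx1.ne']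
    ring
  have h2 : HasDerivAt (fun x : ℝ => x / (x - 1)) (-1 / (x - 1) ^ 2) x := by
    refine ((hasDerivAt_id x).fun_div ((hasDerivAt_id x).sub_const 1) hx1').congr_deriv ?_
    rw [id_eq]
    ring
  refine ⟨_, h1.mul (HasDerivAt.comp (h₂ := pochRatioSeries a) x hD h2), ?_⟩
  set G := pochRatioSeries a (x / (x - 1))
  have e1 : x * (-1 / (x - 1) ^ 2) = x / (x - 1) * (1 - x / (x - 1)) := by
    field_simp
    ring
  have e2 : 1 + x / (x - 1) = (1 - 2 * x) / (1 - x) := by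
    field_simp
    ring
  rw [e2] at hode
  have e3 : a * (1 - 2 * x) / (1 - x) = a - a * x / (1 - x) := by
    field_simp
    ring
  linear_combination (1 - x) ^ (-a) * hode + (1 - x) ^ (-a) * D * e1 + (1 - x) ^ (-a) * G * e3

theorem hypergeometric_eventuallyEq_pfaff {a : ℝ} (ha : |a| < 1 / 2) :
    ordinaryHypergeometric a (-a) (1 - a) =ᶠ[𝓝 (0 : ℝ)]
      fun x => (1 - x) ^ (-a) * pochRatioSeries a (x / (x - 1)) := by
  obtain ⟨h1, h2⟩ := abs_lt.1 ha
  have hF : AnalyticAt ℝ (ordinaryHypergeometric a (-a) (1 - a)) (0 : ℝ) :=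
    analyticOnNhd_hypergeometric ha 0 (by simp)
  have hP := analyticOnNhd_pfaff ha 0 (by simp)
  have hev : ∀ᶠ x : ℝ in 𝓝 0, |x| < 1 / 2 := by
    have := Metric.ball_mem_nhds (0 : ℝ) (ε := 1 / 2) (by norm_num)
    filter_upwards [this] with x hx
    simpa using hx
  have h0 := AnalyticAt.eventually_eq_zero_of_mul_deriv_eq (a := a) (by linarith) (hF.sub hP)
    (by
      have := tsum_eq_single (L := .unconditional ℕ) (f := fun n : ℕ =>
        upperFactorial a n / upperFactorial (1 - a) n * (0 : ℝ) ^ n) 0 (by simp +contextual)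
      simp [pochRatioSeries, this, upperFactorial_zero]) (by
      filter_upwards [hev] with x hx
      obtain ⟨D, hD, e⟩ := hypergeometric_ode ha (x := x) (by linarith)
      obtain ⟨D', hD', e'⟩ := pfaff_ode ha (x := x) (by linarith [le_abs_self x])
      rw [(hD.sub hD').deriv]
      simp only [Pi.sub_apply]
      linear_combination e - e')
  filter_upwards [h0] with x hx
  simpa [sub_eq_zero] using hx

/-- The Pfaff form is analytic on x < 1/2 and the series on |x| < 1. They agree on (-1, 1/2) by the
identity theorem, so they glue to a function on x < 1. Without this existence `gaussHyp` would take
its default value 0. -/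
theorem exists_analytic_continuation_hypergeometric {a : ℝ} (ha : |a| < 1 / 2) :
    ∃ f : ℝ → ℝ, AnalyticOnNhd ℝ f (Set.Iio 1) ∧
      ∀ y : ℝ, |y| < 1 → f y = ordinaryHypergeometric a (-a) (1 - a) y := by
  have hEq : Set.EqOn (fun x : ℝ => ordinaryHypergeometric a (-a) (1 - a) x)
      (fun x => (1 - x) ^ (-a) * pochRatioSeries a (x / (x - 1))) (Set.Ioo (-1) (1 / 2)) := by
    refine AnalyticOnNhd.eqOn_of_preconnected_of_eventuallyEq
      ((analyticOnNhd_hypergeometric ha).mono ?_) ((analyticOnNhd_pfaff ha).mono ?_)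
      isPreconnected_Ioo (z₀ := 0) (by norm_num) (hypergeometric_eventuallyEq_pfaff ha)
    · rintro x ⟨h1, h2⟩
      exact abs_lt.2 ⟨h1, by linarith⟩
    · exact fun x hx => hx.2
  let f : ℝ → ℝ := fun x => if x < 1 / 2 then (1 - x) ^ (-a) * pochRatioSeries a (x / (x - 1))
    else ordinaryHypergeometric a (-a) (1 - a) x
  have hf : ∀ y : ℝ, |y| < 1 → f y = ordinaryHypergeometric a (-a) (1 - a) y := by
    intro y hy
    by_cases h : y < 1 / 2
    · simp only [f, if_pos h]
      exact (hEq ⟨(abs_lt.1 hy).1, h⟩).symm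
    · simp only [f, if_neg h]
  refine ⟨f, fun x hx => ?_, hf⟩
  by_cases h : x < 1 / 2
  · refine (analyticOnNhd_pfaff ha x h).congr ?_
    filter_upwards [Iio_mem_nhds h] with y hy
    exact (if_pos hy).symm
  · have hx1 : |x| < 1 := abs_lt.2 ⟨by linarith, hx⟩
    refine (analyticOnNhd_hypergeometric ha x hx1).congr ?_
    filter_upwards [(isOpen_lt continuous_abs continuous_const).mem_nhds hx1] with y hy
    exact (hf y hy).symm

theorem gaussHyp_eq_pfaff {a : ℝ} (ha : |a| < 1 / 2) {x : ℝ} (hx : x < 1 / 2) :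
    gaussHyp a (-a) (1 - a) x = (1 - x) ^ (-a) * pochRatioSeries a (x / (x - 1)) := by
  have hex := exists_analytic_continuation_hypergeometric ha
  have hx1 : x < 1 := by linarith
  rw [gaussHyp, dif_pos ⟨hx1, hex⟩]
  obtain ⟨hf, hfe⟩ := hex.choose_spec
  -- The continuation inside `gaussHyp` is an arbitrary choice; the identity theorem on the
  -- half-line determines it from its germ at 0.
  refine AnalyticOnNhd.eqOn_of_preconnected_of_eventuallyEq (hf.mono ?_) (analyticOnNhd_pfaff ha)
    isPreconnected_Iio (z₀ := 0) (by norm_num) ?_ hx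
  · exact Set.Iio_subset_Iio (by norm_num)
  · refine Filter.EventuallyEq.trans ?_ (hypergeometric_eventuallyEq_pfaff ha)
    filter_upwards [(isOpen_lt continuous_abs continuous_const).mem_nhds
      (show |(0 : ℝ)| < 1 by simp)] with y hy
    exact hfe y hy

/-! ### Beta integrals -/

/-- Read off from the fact that the Beta distribution has total mass 1. -/
theorem setIntegral_rpow_mul_one_sub_rpow {p q : ℝ} (hp : 0 < p) (hq : 0 < q) :
    ∫ x in Set.Ioo (0 : ℝ) 1, x ^ (p - 1) * (1 - x) ^ (q - 1) =
      Real.Gamma p * Real.Gamma q / Real.Gamma (p + q) := by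
  have hb := ProbabilityTheory.beta_pos hp hq
  have h := ProbabilityTheory.lintegral_betaPDF_eq_one hp hq
  rw [ProbabilityTheory.lintegral_betaPDF] at h
  have h' : ∫ x in Set.Ioo (0 : ℝ) 1,
      1 / ProbabilityTheory.beta p q * x ^ (p - 1) * (1 - x) ^ (q - 1) = 1 := by
    rw [integral_eq_lintegral_of_nonneg_ae, h, ENNReal.toReal_one]
    · refine (ae_restrict_iff' measurableSet_Ioo).2 (.of_forall fun x hx => ?_)
      have : 0 < 1 - x := by linarith [hx.2]
      have := hx.1
      simp only [Pi.zero_apply]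
      positivity
    · exact (by fun_prop : Measurable fun x : ℝ =>
        1 / ProbabilityTheory.beta p q * x ^ (p - 1) * (1 - x) ^ (q - 1)).aestronglyMeasurable
  simp only [mul_assoc] at h'
  rw [integral_const_mul, one_div, inv_mul_eq_iff_eq_mul₀ hb.ne', mul_one] at h'
  rw [h', ProbabilityTheory.beta]

theorem integrableOn_rpow_mul_one_sub_rpow {p q : ℝ} (hp : 0 < p) (hq : 0 < q) :
    IntegrableOn (fun x : ℝ => x ^ (p - 1) * (1 - x) ^ (q - 1)) (Set.Ioo 0 1) := by
  -- A nonintegrable function has Bochner integral 0 by convention, so a nonzero value proves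
  -- integrability.
  refine Integrable.of_integral_ne_zero ?_
  rw [setIntegral_rpow_mul_one_sub_rpow hp hq]
  exact (ProbabilityTheory.beta_pos hp hq).ne'

/-! ### A telescoping series -/

theorem abs_upperFactorial_div_factorial_le {a : ℝ} (ha : |a| < 1 / 2) (n : ℕ) :
    |upperFactorial a n / n.factorial| ≤ 1 / ((n : ℝ) + 1) ^ (1 / 2 : ℝ) := by
  obtain ⟨h1, h2⟩ := abs_lt.1 ha
  -- Squaring avoids roots in the induction, which then rests on (n + 1/2)² (n + 2) ≤ (n + 1)³.
  have key : ∀ n : ℕ, (upperFactorial a n / n.factorial) ^ 2 * (n + 1) ≤ 1 := by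
    intro n
    induction n with
    | zero => simp [upperFactorial_zero]
    | succ n ih =>
      have hn : (0 : ℝ) ≤ n := n.cast_nonneg
      rw [upperFactorial_succ, Nat.factorial_succ, Nat.cast_mul, Nat.cast_succ,
        mul_comm ((n : ℝ) + 1), mul_div_mul_comm, mul_pow, mul_assoc]
      refine le_trans ?_ ih
      gcongr
      rw [div_pow, div_mul_eq_mul_div, div_le_iff₀ (by positivity)]
      have h3 : (a + n) ^ 2 ≤ (n + 1 / 2) ^ 2 :=
        sq_le_sq.2 ((abs_le.2 ⟨by linarith, by linarith⟩).trans (le_abs_self _))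
      nlinarith [mul_le_mul_of_nonneg_right h3 (by positivity : (0 : ℝ) ≤ n + 1 + 1)]
  rw [← Real.sqrt_eq_rpow, le_div_iff₀ (by positivity), ← Real.sqrt_sq_eq_abs,
    ← Real.sqrt_mul (by positivity)]
  exact Real.sqrt_le_one.2 (key n)

theorem abs_upperFactorial_div_factorial_add_le {a : ℝ} (ha : |a| < 1 / 2) (k n : ℕ) :
    |upperFactorial a n / (k + n).factorial| ≤ 1 / ((n : ℝ) + 1) ^ (1 / 2 : ℝ) := by
  refine le_trans ?_ (abs_upperFactorial_div_factorial_le ha n)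
  rw [abs_div, abs_div, Nat.abs_cast, Nat.abs_cast]
  gcongr
  omega

theorem summable_upperFactorial_div_factorial {a : ℝ} (ha : |a| < 1 / 2) (k : ℕ) :
    Summable fun n : ℕ => |upperFactorial a n / (k + n + 1).factorial| := by
  have hs : Summable fun n : ℕ => 1 / ((n : ℝ) + 1) ^ (3 / 2 : ℝ) := by
    have := (summable_nat_add_iff 1).2 (Real.summable_one_div_nat_rpow.2
      (by norm_num : (1 : ℝ) < 3 / 2))
    simpa using this
  refine hs.of_nonneg_of_le (fun n => abs_nonneg _) fun n => ?_
  have h := abs_upperFactorial_div_factorial_add_le ha k n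
  have hn : (0 : ℝ) < n + 1 := by positivity
  rw [Nat.factorial_succ, Nat.cast_mul, mul_comm, ← div_div, abs_div, Nat.abs_cast,
    show (3 / 2 : ℝ) = 1 / 2 + 1 by norm_num, Real.rpow_add_one hn.ne', ← div_div]
  gcongr
  push_cast
  linarith [(k.cast_nonneg : (0 : ℝ) ≤ k)]

/-- The series telescopes: (a)ₙ/(k+n)! - (a)ₙ₊₁/(k+n+1)! = (k + 1 - a) (a)ₙ/(k+n+1)!. The bound
n^(-1/2) makes the remainder vanish even for k = 0. -/
theorem hasSum_upperFactorial_div_factorial {a : ℝ} (ha : |a| < 1 / 2) (k : ℕ) :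
    HasSum (fun n : ℕ => upperFactorial a n / (k + n + 1).factorial)
      (1 / ((k + 1 - a) * k.factorial)) := by
  obtain ⟨h1, h2⟩ := abs_lt.1 ha
  have hk : (0 : ℝ) < k + 1 - a := by linarith [(k.cast_nonneg : (0 : ℝ) ≤ k)]
  have hlim : Filter.Tendsto (fun n : ℕ => upperFactorial a n / (k + n).factorial) .atTop
      (𝓝 0) := by
    refine squeeze_zero_norm (abs_upperFactorial_div_factorial_add_le ha k) ?_
    have := (tendsto_rpow_neg_atTop (by norm_num : (0 : ℝ) < 1 / 2)).comp
      (Filter.tendsto_atTop_add_const_right _ (1 : ℝ) tendsto_natCast_atTop_atTop)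
    refine this.congr fun n => ?_
    have hn : (0 : ℝ) ≤ n + 1 := by positivity
    rw [Function.comp_apply, Real.rpow_neg hn, ← one_div]
  have hpart : ∀ N : ℕ, ∑ n ∈ range N, upperFactorial a n / ((k + n + 1).factorial : ℝ) =
      (1 / k.factorial - upperFactorial a N / (k + N).factorial) / (k + 1 - a) := by
    intro N
    induction N with
    | zero => simp [upperFactorial_zero]
    | succ N ih =>
      rw [sum_range_succ, ih, upperFactorial_succ, ← add_assoc k N 1, Nat.factorial_succ (k + N)]
      push_cast
      have : (k : ℝ) + N + 1 ≠ 0 := by positivity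
      field_simp
      ring
  refine ((summable_upperFactorial_div_factorial ha k).of_abs.hasSum_iff_tendsto_nat).2 ?_
  simp_rw [hpart]
  have := (hlim.const_sub (1 / (k.factorial : ℝ))).div_const (k + 1 - a)
  convert this using 2
  field_simp
  ring

/-! ### The profile of the kernel -/

/-- The function `ψ` with `k_H(t, τ) = (a_H / Γ(H + 1/2)) t^(H - 1/2) ψ(τ / t)` for `t, τ > 0`,
where `a = 1/2 - H`. -/
noncomputable def kernelProfile (a : ℝ) : ℝ → ℝ :=
  (Set.Ioo 0 1).indicator fun u => u ^ a * (1 - u) ^ (-a) * pochRatioSeries a (1 - u)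

theorem integral_pow_mul_kernelProfile {a : ℝ} (ha : |a| < 1 / 2) (k : ℕ) :
    ∫ u, u ^ k * kernelProfile a u =
      Real.Gamma (1 - a) * Real.Gamma (k + 1 + a) / ((k + 1 - a) * k.factorial) := by
  obtain ⟨h1, h2⟩ := abs_lt.1 ha
  have hk0 : (0 : ℝ) ≤ k := k.cast_nonneg
  let F : ℕ → ℝ → ℝ := fun n u => upperFactorial a n / upperFactorial (1 - a) n *
    (u ^ ((k + 1 + a) - 1) * (1 - u) ^ ((1 - a + n) - 1))
  have hp : 0 < k + 1 + a := by linarith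
  have hq : ∀ n : ℕ, 0 < 1 - a + n := fun n => by linarith [(n.cast_nonneg : (0 : ℝ) ≤ n)]
  have hint : ∀ n, Integrable (F n) (volume.restrict (Set.Ioo 0 1)) := fun n =>
    (integrableOn_rpow_mul_one_sub_rpow hp (hq n)).const_mul _
  -- The numerator is left free: c = (a)ₙ gives the integral of `F n`, and c = |(a)ₙ| gives that of
  -- its norm.
  have hval : ∀ c : ℝ, ∀ n : ℕ, ∫ u in Set.Ioo (0 : ℝ) 1, c / upperFactorial (1 - a) n *
      (u ^ ((k + 1 + a) - 1) * (1 - u) ^ ((1 - a + n) - 1)) =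
      Real.Gamma (1 - a) * Real.Gamma (k + 1 + a) * (c / (k + n + 1).factorial) := by
    intro c n
    have hpos := upperFactorial_pos (x := 1 - a) (by linarith) n
    rw [integral_const_mul, setIntegral_rpow_mul_one_sub_rpow hp (hq n),
      Gamma_add_natCast (by linarith) n,
      show k + 1 + a + (1 - a + n) = ((k + n + 1 : ℕ) : ℝ) + 1 by push_cast; ring,
      Real.Gamma_nat_eq_factorial]
    field_simp
  have hnorm : ∀ n, ∫ u in Set.Ioo (0 : ℝ) 1, ‖F n u‖ =
      Real.Gamma (1 - a) * Real.Gamma (k + 1 + a) *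
        |upperFactorial a n / (k + n + 1).factorial| := by
    intro n
    rw [abs_div, Nat.abs_cast, ← hval]
    refine setIntegral_congr_fun measurableSet_Ioo fun u hu => ?_
    have hu0 := hu.1
    have hu1 : 0 < 1 - u := by linarith [hu.2]
    have hpos := upperFactorial_pos (x := 1 - a) (by linarith) n
    simp only [F]
    rw [norm_mul, norm_div, Real.norm_eq_abs, Real.norm_of_nonneg hpos.le,
      Real.norm_of_nonneg (by positivity)]
  have hsum := hasSum_integral_of_summable_integral_norm hint
    (by simp_rw [hnorm]; exact (summable_upperFactorial_div_factorial ha k).mul_left _)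
  have hsum' := (hasSum_upperFactorial_div_factorial ha k).mul_left
    (Real.Gamma (1 - a) * Real.Gamma (k + 1 + a))
  have heq := hsum.unique (hsum'.congr_fun fun n => hval _ n)
  rw [mul_one_div] at heq
  rw [← heq, ← integral_indicator measurableSet_Ioo]
  congr 1 with u
  by_cases hu : u ∈ Set.Ioo (0 : ℝ) 1
  · have hu1 : 0 < 1 - u := by linarith [hu.2]
    rw [kernelProfile, Set.indicator_of_mem hu, Set.indicator_of_mem hu, pochRatioSeries,
      ← tsum_mul_left, ← tsum_mul_left]
    refine tsum_congr fun n => ?_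
    simp only [F]
    rw [show k + 1 + a - 1 = a + k by ring, show 1 - a + n - 1 = -a + n by ring,
      Real.rpow_add_natCast hu.1.ne', Real.rpow_add_natCast hu1.ne']
    ring
  · rw [kernelProfile, Set.indicator_of_notMem hu, Set.indicator_of_notMem hu, mul_zero]

theorem integrable_pow_mul_kernelProfile {a : ℝ} (ha : |a| < 1 / 2) (k : ℕ) :
    Integrable fun u => u ^ k * kernelProfile a u := by
  refine Integrable.of_integral_ne_zero ?_
  obtain ⟨h1, h2⟩ := abs_lt.1 ha
  have hk0 : (0 : ℝ) ≤ k := k.cast_nonneg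
  rw [integral_pow_mul_kernelProfile ha]
  have := Real.Gamma_pos_of_pos (by linarith : 0 < 1 - a)
  have := Real.Gamma_pos_of_pos (by linarith : 0 < k + 1 + a)
  have : 0 < k + 1 - a := by linarith
  positivity

theorem continuousOn_kernelProfile {a : ℝ} (ha : |a| < 1 / 2) :
    ContinuousOn (kernelProfile a) (Set.Ioo 0 1) := by
  have hG := (analyticOnNhd_tsum_mul_pow (abs_upperFactorial_div_le_one ha)).continuousOn
  have : ContinuousOn (fun u : ℝ => u ^ a * (1 - u) ^ (-a) * pochRatioSeries a (1 - u))
      (Set.Ioo 0 1) := by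
    refine ((continuousOn_id.rpow_const fun u hu => Or.inl hu.1.ne').mul
      ((continuousOn_const.sub continuousOn_id).rpow_const fun u hu => Or.inl ?_)).mul
      (hG.comp (continuousOn_const.sub continuousOn_id) fun u hu => ?_)
    · exact (sub_pos.2 hu.2).ne'
    · have h0 := hu.1
      have h1 := hu.2
      change |1 - u| < 1
      exact abs_lt.2 ⟨by linarith, by linarith⟩
  exact this.congr fun u hu => Set.indicator_of_mem hu _

/-! ### The kernel -/

theorem fbmKernel_eq_profile {H : ℝ} (hH : H ∈ Set.Ioo (0 : ℝ) 1) {t τ : ℝ} (ht : 0 < t)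
    (hτ : 0 < τ) :
    fbmKernel H t τ = fbmConst H / Real.Gamma (H + 1 / 2) * t ^ (H - 1 / 2) *
      kernelProfile (1 / 2 - H) (τ / t) := by
  have ha : |1 / 2 - H| < 1 / 2 := abs_lt.2 ⟨by linarith [hH.2], by linarith [hH.1]⟩
  rw [fbmKernel]
  split_ifs with h
  · have hlt : τ < t := by linarith
    have hmem : τ / t ∈ Set.Ioo (0 : ℝ) 1 := ⟨by positivity, (div_lt_one ht).2 hlt⟩
    have h1 : 1 < t / τ := (one_lt_div hτ).2 hlt
    have hg := gaussHyp_eq_pfaff ha (x := 1 - t / τ) (by linarith)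
    rw [show -(1 / 2 - H) = H - 1 / 2 by ring, show 1 - (1 / 2 - H) = H + 1 / 2 by ring] at hg
    have hz : (1 - t / τ) / (1 - t / τ - 1) = 1 - τ / t := by
      rw [div_eq_iff (by linarith)]
      have : τ / t * (t / τ) = 1 := by field_simp
      linear_combination -this
    rw [hg, kernelProfile, Set.indicator_of_mem hmem,
      hz,
      show 1 - (1 - t / τ) = (τ / t)⁻¹ by rw [inv_div]; ring,
      show t - τ = t * (1 - τ / t) by rw [mul_sub, mul_div_cancel₀ _ ht.ne', mul_one],
      Real.mul_rpow ht.le (by linarith [hmem.2]), Real.inv_rpow hmem.1.le,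
      ← Real.rpow_neg hmem.1.le]
    rw [show -(H - 1 / 2) = 1 / 2 - H by ring, show -(1 / 2 - H) = H - 1 / 2 by ring]
    ring
  · have hmem : τ / t ∉ Set.Ioo (0 : ℝ) 1 := fun hm => h (by linarith [(div_lt_one ht).1 hm.2])
    rw [kernelProfile, Set.indicator_of_notMem hmem, mul_zero]

/-- Since ψ lives on (0,1) and t ≤ T, the cut-off at T is invisible, and the substitution u = τ/t
applies on the whole line. -/
theorem setIntegral_comp_div_of_eqOn {T t : ℝ} (ht : t ∈ Set.Ioc 0 T) {ψ : ℝ → ℝ}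
    (hψ : ∀ u ∉ Set.Ioo (0 : ℝ) 1, ψ u = 0) {f : ℝ → ℝ} (c : ℝ)
    (hf : ∀ τ ∈ Set.Ioc 0 T, f τ = c * ψ (τ / t)) :
    ∫ τ in Set.Ioc 0 T, f τ = c * t * ∫ u, ψ u := by
  rw [setIntegral_congr_fun measurableSet_Ioc hf, integral_const_mul,
    setIntegral_eq_integral_of_forall_compl_eq_zero, Measure.integral_comp_div,
    abs_of_pos ht.1, smul_eq_mul, mul_assoc]
  intro τ hτ
  refine hψ _ fun hm => hτ ⟨?_, ?_⟩
  · exact (div_pos_iff_of_pos_right ht.1).1 hm.1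
  · exact ((div_lt_one ht.1).1 hm.2).le.trans ht.2

theorem pow_mul_fbmKernel_eq {H : ℝ} (hH : H ∈ Set.Ioo (0 : ℝ) 1) {t τ : ℝ} (ht : 0 < t)
    (hτ : 0 < τ) (k : ℕ) :
    τ ^ k * fbmKernel H t τ = fbmConst H / Real.Gamma (H + 1 / 2) * t ^ (H - 1 / 2) * t ^ k *
      ((τ / t) ^ k * kernelProfile (1 / 2 - H) (τ / t)) := by
  rw [fbmKernel_eq_profile hH ht hτ, div_pow]
  field_simp

theorem integrableOn_pow_mul_fbmKernel {T H : ℝ} (hH : H ∈ Set.Ioo (0 : ℝ) 1) {t : ℝ}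
    (ht : 0 < t) (k : ℕ) :
    IntegrableOn (fun τ => τ ^ k * fbmKernel H t τ) (Set.Ioc 0 T) := by
  have ha : |1 / 2 - H| < 1 / 2 := abs_lt.2 ⟨by linarith [hH.2], by linarith [hH.1]⟩
  have h := ((integrable_pow_mul_kernelProfile ha k).comp_div ht.ne').const_mul
    (fbmConst H / Real.Gamma (H + 1 / 2) * t ^ (H - 1 / 2) * t ^ k)
  exact h.integrableOn.congr_fun (fun τ hτ => (pow_mul_fbmKernel_eq hH ht hτ.1 k).symm)
    measurableSet_Ioc

theorem setIntegral_pow_mul_fbmKernel {T H : ℝ} (hH : H ∈ Set.Ioo (0 : ℝ) 1) {t : ℝ}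
    (ht : t ∈ Set.Ioc 0 T) (k : ℕ) :
    ∫ τ in Set.Ioc 0 T, τ ^ k * fbmKernel H t τ =
      fbmConst H * Real.Gamma (3 / 2 - H) * upperFactorial (3 / 2 - H) k /
        ((H + 1 / 2 + k) * k.factorial) * t ^ (H + 1 / 2 + k) := by
  have ha : |1 / 2 - H| < 1 / 2 := abs_lt.2 ⟨by linarith [hH.2], by linarith [hH.1]⟩
  rw [setIntegral_comp_div_of_eqOn ht (ψ := fun u => u ^ k * kernelProfile (1 / 2 - H) u)
    (fun u hu => by simp [kernelProfile, Set.indicator_of_notMem hu])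
    _ (fun τ hτ => pow_mul_fbmKernel_eq hH ht.1 hτ.1 k), integral_pow_mul_kernelProfile ha,
    show (k : ℝ) + 1 + (1 / 2 - H) = 3 / 2 - H + k by ring,
    Gamma_add_natCast (by linarith [hH.2]), show 1 - (1 / 2 - H) = H + 1 / 2 by ring,
    show H + 1 / 2 + k = H - 1 / 2 + k + 1 by ring, Real.rpow_add_one ht.1.ne',
    Real.rpow_add_natCast ht.1.ne', show (k : ℝ) + 1 - (1 / 2 - H) = H - 1 / 2 + k + 1 by ring]
  have hG := (Real.Gamma_pos_of_pos (by linarith [hH.1] : 0 < H + 1 / 2)).ne'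
  have hk : H - 1 / 2 + k + 1 ≠ 0 := by linarith [hH.1, (k.cast_nonneg : (0 : ℝ) ≤ k)]
  generalize Real.Gamma (H + 1 / 2) = g at *
  field_simp

/-- The kernel is continuous on the open triangle 0 < τ < t, through its profile, and zero on the
rest of the square. -/
theorem aestronglyMeasurable_fbmKernel {T H : ℝ} (hH : H ∈ Set.Ioo (0 : ℝ) 1) :
    AEStronglyMeasurable (fun p : ℝ × ℝ => fbmKernel H p.1 p.2)
      ((volume.restrict (Set.Ioc 0 T)).prod (volume.restrict (Set.Ioc 0 T))) := by
  have ha : |1 / 2 - H| < 1 / 2 := abs_lt.2 ⟨by linarith [hH.2], by linarith [hH.1]⟩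
  let U : Set (ℝ × ℝ) := {p | 0 < p.2 ∧ p.2 < p.1}
  have hU : MeasurableSet U := by
    refine (IsOpen.inter ?_ ?_).measurableSet
    · exact isOpen_lt continuous_const continuous_snd
    · exact isOpen_lt continuous_snd continuous_fst
  have hcont : ContinuousOn (fun p : ℝ × ℝ => fbmConst H / Real.Gamma (H + 1 / 2) *
      p.1 ^ (H - 1 / 2) * kernelProfile (1 / 2 - H) (p.2 / p.1)) U := by
    have hpos : ∀ p ∈ U, p.1 ≠ 0 := fun p hp => (hp.1.trans hp.2).ne'
    refine (continuousOn_const.mul (continuousOn_fst.rpow_const fun p hp => Or.inl (hpos p hp))).mul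
      ((continuousOn_kernelProfile ha).comp (continuousOn_snd.div continuousOn_fst hpos) ?_)
    exact fun p hp => ⟨div_pos hp.1 (hp.1.trans hp.2), (div_lt_one (hp.1.trans hp.2)).2 hp.2⟩
  have hmeas := (aestronglyMeasurable_indicator_iff hU
    (μ := (volume.restrict (Set.Ioc 0 T)).prod (volume.restrict (Set.Ioc 0 T)))).2
    (hcont.aestronglyMeasurable hU)
  refine hmeas.congr ?_
  rw [Measure.prod_restrict]
  refine (ae_restrict_iff' (measurableSet_Ioc.prod measurableSet_Ioc)).2 (.of_forall ?_)
  rintro p ⟨hp1, hp2⟩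
  change _ = fbmKernel H p.1 p.2
  by_cases hp : p ∈ U
  · rw [Set.indicator_of_mem hp, fbmKernel_eq_profile hH hp1.1 hp2.1]
  · rw [Set.indicator_of_notMem hp, fbmKernel, if_neg]
    exact fun h => hp ⟨hp2.1, by linarith⟩

/-- Discards the null edges t = 0 and τ = 0, where the homogeneous form of the kernel is not
available. -/
theorem restrict_Icc_prod_Icc (T : ℝ) :
    (volume : Measure (ℝ × ℝ)).restrict (Set.Icc 0 T ×ˢ Set.Icc 0 T) =
      (volume.restrict (Set.Ioc 0 T)).prod (volume.restrict (Set.Ioc 0 T)) := by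
  rw [Measure.volume_eq_prod, ← Measure.prod_restrict, Measure.restrict_congr_set Ioc_ae_eq_Icc]

theorem integrableOn_fbmKernel {T H : ℝ} (hH : H ∈ Set.Ioo (0 : ℝ) 1) :
    IntegrableOn (fun p : ℝ × ℝ => fbmKernel H p.1 p.2) (Set.Icc 0 T ×ˢ Set.Icc 0 T) := by
  rw [IntegrableOn, restrict_Icc_prod_Icc, integrable_prod_iff (aestronglyMeasurable_fbmKernel hH)]
  constructor
  · refine (ae_restrict_iff' measurableSet_Ioc).2 (.of_forall fun t ht => ?_)
    simpa [IntegrableOn] using integrableOn_pow_mul_fbmKernel (T := T) hH ht.1 0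
  -- Homogeneity also gives the inner L¹ norm: a constant times t^(H+1/2), continuous in t because
  -- the exponent is positive.
  · have hnorm : ∀ t ∈ Set.Ioc 0 T, ∫ τ in Set.Ioc 0 T, ‖fbmKernel H t τ‖ =
        |fbmConst H / Real.Gamma (H + 1 / 2)| * t ^ (H + 1 / 2) *
          ∫ u, |kernelProfile (1 / 2 - H) u| := by
      intro t ht
      rw [setIntegral_comp_div_of_eqOn ht (ψ := fun u => |kernelProfile (1 / 2 - H) u|)
        (fun u hu => by simp [kernelProfile, Set.indicator_of_notMem hu])
        (|fbmConst H / Real.Gamma (H + 1 / 2)| * t ^ (H - 1 / 2)) (fun τ hτ => ?_),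
        show H + 1 / 2 = H - 1 / 2 + 1 by ring, Real.rpow_add_one ht.1.ne']
      · ring
      · rw [fbmKernel_eq_profile hH ht.1 hτ.1, Real.norm_eq_abs, abs_mul, abs_mul,
          abs_of_nonneg (Real.rpow_nonneg ht.1.le _)]
    refine IntegrableOn.congr_fun ?_ (fun t ht => (hnorm t ht).symm) measurableSet_Ioc
    refine IntegrableOn.mono_set ?_ Set.Ioc_subset_Icc_self
    refine ContinuousOn.integrableOn_Icc (Continuous.continuousOn ?_)
    exact (continuous_const.mul (Real.continuous_rpow_const (by linarith [hH.1]))).mul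
      continuous_const

/-! ### Coefficients of the shifted Legendre polynomials -/

theorem legendreCoeff_succ_mul {i m : ℕ} (h : m ≤ i) :
    legendreCoeff (i + 1) m * (i + 1 - m) = -((i + 1 + m) * legendreCoeff i m) := by
  obtain ⟨d, rfl⟩ := Nat.exists_eq_add_of_le h
  have e1 := Nat.add_one_mul_choose_eq (m + d + m) (m + d)
  have e2 := Nat.add_one_mul_choose_eq (m + d) d
  have h1 : m + d + 1 + m = m + d + m + 1 := by ring
  have h2 : m + d + 1 - m = d + 1 := by omega
  have h3 : m + d - m = d := by omega
  rw [legendreCoeff, legendreCoeff, h1, h2, h3]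
  generalize (m + d + m).choose (m + d) = p at *
  generalize (m + d + m + 1).choose (m + d + 1) = p' at *
  generalize (m + d).choose d = q at *
  generalize (m + d + 1).choose (d + 1) = q' at *
  have e1' : ((m : ℝ) + d + m + 1) * p = p' * (m + d + 1) := by exact_mod_cast e1
  have e2' : ((m : ℝ) + d + 1) * q = q' * (d + 1) := by exact_mod_cast e2
  have hne : (m : ℝ) + d + 1 ≠ 0 := by positivity
  apply mul_left_cancel₀ hne
  push_cast
  rw [pow_succ]
  linear_combination (-1) ^ d * p' * (m + d + 1) * e2' + (-1) ^ d * (m + d + 1) * q * e1'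

/-- This is P_i(1) = 1: up to the sign (-1)^i the coefficients are those of
`Polynomial.shiftedLegendre`, and the reflection x → 1 - x moves the evaluation to the constant
term. -/
theorem sum_legendreCoeff (i : ℕ) : ∑ m ∈ range (i + 1), legendreCoeff i m = 1 := by
  have h := Polynomial.shiftedLegendre_eval_symm i (1 : ℝ)
  rw [sub_self, ← Polynomial.coeff_zero_eq_aeval_zero', Polynomial.coeff_shiftedLegendre] at h
  simp only [Polynomial.shiftedLegendre, map_sum, map_mul, Polynomial.aeval_C, map_pow,
    Polynomial.aeval_X, one_pow, mul_one] at h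
  have h2 := congrArg (fun x => (-1 : ℝ) ^ i * x) h
  simp only [mul_sum] at h2
  have h3 : ((-1 : ℝ) ^ i * (-1) ^ i) = 1 := by rw [← mul_pow]; simp
  simp only [← mul_assoc, h3] at h2
  refine (sum_congr rfl fun m hm => ?_).trans (h2.trans (by simp))
  have hm : m ≤ i := Nat.lt_succ_iff.1 (mem_range.1 hm)
  have e : (-1 : ℝ) ^ (i - m) = (-1) ^ i * (-1) ^ m := by
    obtain ⟨d, rfl⟩ := Nat.exists_eq_add_of_le hm
    rw [Nat.add_sub_cancel_left, pow_add, mul_right_comm, ← mul_pow]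
    simp
  rw [legendreCoeff, Nat.choose_symm hm, e]
  simp
  ring

theorem sum_legendreCoeff_div_succ {α : ℝ} (hα : 0 < α) (i : ℕ) :
    (α + i + 2) * ∑ m ∈ range (i + 1 + 1), legendreCoeff (i + 1) m / (α + m + 1) =
      (α - i) * ∑ m ∈ range (i + 1), legendreCoeff i m / (α + m + 1) := by
  have h1 := sum_legendreCoeff (i + 1)
  have h0 := sum_legendreCoeff i
  rw [sum_range_succ] at h1
  rw [sum_range_succ, mul_add, mul_sum, mul_sum]
  -- Write α + i + 2 = (α + m + 1) + (i + 1 - m) and α - i = (α + m + 1) - (i + 1 + m): by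
  -- `legendreCoeff_succ_mul` the second parts match. The leftover differences, with the top term m
  -- = i + 1, sum to 1 - 1 = 0.
  have key : ∑ m ∈ range (i + 1), (α + i + 2) * (legendreCoeff (i + 1) m / (α + m + 1)) =
      ∑ m ∈ range (i + 1), ((α - i) * (legendreCoeff i m / (α + m + 1)) +
        (legendreCoeff (i + 1) m - legendreCoeff i m)) := by
    refine sum_congr rfl fun m hm => ?_
    have hm : m ≤ i := Nat.lt_succ_iff.1 (mem_range.1 hm)
    have := legendreCoeff_succ_mul hm
    have hne : α + m + 1 ≠ 0 := by positivity
    field_simp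
    linear_combination this
  rw [key, sum_add_distrib, sum_sub_distrib]
  have hne : α + i + 2 ≠ 0 := by positivity
  have : (α + i + 2) * (legendreCoeff (i + 1) (i + 1) / (α + (i + 1 : ℕ) + 1)) =
      legendreCoeff (i + 1) (i + 1) := by
    push_cast
    rw [show α + (i + 1) + 1 = α + i + 2 by ring]
    field_simp
  rw [this]
  linear_combination h1 - h0

theorem lowerFactorial_succ (x : ℝ) (n : ℕ) :
    lowerFactorial x (n + 1) = lowerFactorial x n * (x - n) := by
  simp [lowerFactorial, descPochhammer_succ_eval]

theorem sum_legendreCoeff_div {α : ℝ} (hα : 0 < α) (i : ℕ) :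
    ∑ m ∈ range (i + 1), legendreCoeff i m / (α + m + 1) =
      lowerFactorial α i / upperFactorial (α + 1) (i + 1) := by
  induction i with
  | zero => simp [legendreCoeff, lowerFactorial, upperFactorial]
  | succ i ih =>
    have h := sum_legendreCoeff_div_succ hα i
    have hne : α + i + 2 ≠ 0 := by positivity
    have hpos := upperFactorial_pos (x := α + 1) (by linarith) (i + 1)
    rw [ih] at h
    rw [← mul_right_inj' hne, h, lowerFactorial_succ, upperFactorial_succ _ (i + 1)]
    push_cast
    rw [show α + 1 + (i + 1) = α + i + 2 by ring]
    field_simp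

/-! ### Legendre coefficients of powers -/

theorem continuous_legendreHat (T : ℝ) (i : ℕ) : Continuous (legendreHat T i) := by
  unfold legendreHat
  fun_prop

theorem integrableOn_rpow_mul_legendreHat {α : ℝ} (hα : 0 < α) (T : ℝ) (i : ℕ) :
    IntegrableOn (fun t : ℝ => t ^ α * legendreHat T i t) (Set.Icc 0 T) :=
  ((Real.continuous_rpow_const hα.le).mul (continuous_legendreHat T i)).integrableOn_Icc

theorem setIntegral_rpow_mul_pow {T α : ℝ} (hT : 0 < T) (hα : 0 < α) (m : ℕ) :
    ∫ t in Set.Icc 0 T, t ^ α * t ^ m = T ^ (α + m + 1) / (α + m + 1) := by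
  have hm : 0 < α + m := by positivity
  rw [integral_Icc_eq_integral_Ioc]
  rw [setIntegral_congr_fun (g := fun t => t ^ (α + m)) measurableSet_Ioc
    fun t ht => (Real.rpow_add_natCast ht.1.ne' α m).symm,
    ← intervalIntegral.integral_of_le hT.le, integral_rpow (Or.inl (by linarith)),
    Real.zero_rpow (by linarith), sub_zero]

theorem powerCoeff_eq_sum {T α : ℝ} (hT : 0 < T) (hα : 0 < α) (i : ℕ) :
    powerCoeff T α i = Real.sqrt ((2 * i + 1) / T) *
      ∑ m ∈ range (i + 1), legendreCoeff i m * (T ^ (α + 1) / (α + m + 1)) := by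
  have e : ∀ t : ℝ, t ^ α * legendreHat T i t = Real.sqrt ((2 * i + 1) / T) *
      ∑ m ∈ range (i + 1), legendreCoeff i m / T ^ m * (t ^ α * t ^ m) := by
    intro t
    rw [legendreHat, mul_left_comm, mul_sum]
    congr 1
    exact sum_congr rfl fun m _ => by ring
  rw [powerCoeff]
  simp_rw [e]
  rw [integral_const_mul, integral_finsetSum]
  · congr 1
    refine sum_congr rfl fun m _ => ?_
    rw [integral_const_mul, setIntegral_rpow_mul_pow hT hα, add_right_comm α m 1,
      Real.rpow_add_natCast hT.ne']
    field_simp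
  · intro m _
    exact (((Real.continuous_rpow_const hα.le).mul (continuous_pow m)).integrableOn_Icc).const_mul _

theorem powerCoeff_eq_mul_sum {T α : ℝ} (hT : 0 < T) (hα : 0 < α) (i : ℕ) :
    powerCoeff T α i = Real.sqrt ((2 * i + 1) / T) * T ^ (α + 1) *
      ∑ m ∈ range (i + 1), legendreCoeff i m / (α + m + 1) := by
  rw [powerCoeff_eq_sum hT hα, mul_assoc, mul_sum (range (i + 1)) _ (T ^ (α + 1))]
  congr 1
  exact sum_congr rfl fun m _ => by ring

theorem powerCoeff_eq_div {T α : ℝ} (hT : 0 < T) (hα : 0 < α) (i : ℕ) :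
    powerCoeff T α i = T ^ α * Real.sqrt T *
      (Real.sqrt (2 * i + 1) * lowerFactorial α i / upperFactorial (α + 1) (i + 1)) := by
  have h : Real.sqrt ((2 * i + 1) / T) * T = Real.sqrt (2 * i + 1) * Real.sqrt T := by
    rw [Real.sqrt_div (by positivity)]
    have hs := Real.mul_self_sqrt hT.le
    have : Real.sqrt T ≠ 0 := (Real.sqrt_pos.2 hT).ne'
    field_simp
    linear_combination -hs
  rw [powerCoeff_eq_mul_sum hT hα, sum_legendreCoeff_div hα, Real.rpow_add_one hT.ne']
  linear_combination T ^ α * (lowerFactorial α i / upperFactorial (α + 1) (i + 1)) * h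

theorem powerCoeff_succ {T α : ℝ} (hT : 0 < T) (hα : 0 < α) (i : ℕ) :
    powerCoeff T α (i + 1) = Real.sqrt ((2 * i + 3) / (2 * i + 1)) *
      ((α - i) / (α + i + 2)) * powerCoeff T α i := by
  have h := sum_legendreCoeff_div_succ hα i
  have hne : α + i + 2 ≠ 0 := by positivity
  replace h := (eq_div_iff hne).2 ((mul_comm _ _).trans h)
  rw [powerCoeff_eq_mul_sum hT hα, powerCoeff_eq_mul_sum hT hα, h]
  have hs : Real.sqrt ((2 * (i + 1 : ℕ) + 1) / T) =
      Real.sqrt ((2 * i + 3) / (2 * i + 1)) * Real.sqrt ((2 * i + 1) / T) := by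
    rw [← Real.sqrt_mul (by positivity)]
    congr 1
    push_cast
    field_simp
    ring
  rw [hs]
  ring

theorem lowerFactorial_add_one_mul (x : ℝ) (n : ℕ) :
    lowerFactorial (x + 1) n * (x + 1 - n) = (x + 1) * lowerFactorial x n := by
  induction n with
  | zero => simp [lowerFactorial]
  | succ n ih =>
    rw [lowerFactorial_succ, lowerFactorial_succ]
    push_cast
    linear_combination (x - n) * ih

theorem upperFactorial_add_one_mul (x : ℝ) (n : ℕ) :
    upperFactorial (x + 1) n * x = upperFactorial x n * (x + n) := by
  induction n with
  | zero => simp [upperFactorial]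
  | succ n ih =>
    rw [upperFactorial_succ, upperFactorial_succ]
    push_cast
    linear_combination (x + 1 + n) * ih

/-- Kept free of division because α + 1 - i may vanish. -/
theorem powerCoeff_add_one {T α : ℝ} (hT : 0 < T) (hα : 0 < α) (i : ℕ) :
    powerCoeff T (α + 1) i * ((α + 1 - i) * (α + i + 2)) =
      T * (α + 1) ^ 2 * powerCoeff T α i := by
  have h1 := lowerFactorial_add_one_mul α i
  have h2 := upperFactorial_add_one_mul (α + 1) (i + 1)
  have hp1 := upperFactorial_pos (x := α + 1) (by linarith) (i + 1)
  have hp2 := upperFactorial_pos (x := α + 1 + 1) (by linarith) (i + 1)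
  push_cast at h2
  rw [powerCoeff_eq_div hT hα, powerCoeff_eq_div hT (by linarith), Real.rpow_add_one hT.ne']
  field_simp
  linear_combination (α + i + 2) * upperFactorial (α + 1) (i + 1) * h1 -
    (α + 1) * lowerFactorial α i * h2

theorem powerCoeff_add_natCast {T α : ℝ} (hT : 0 < T) (hα : 0 < α) (i : ℕ)
    (hne : ∀ n : ℕ, α - i + 1 + n ≠ 0) (k : ℕ) :
    powerCoeff T (α + k) i = T ^ k * upperFactorial (α + 1) k ^ 2 /
      (upperFactorial (α - i + 1) k * upperFactorial (α + i + 2) k) * powerCoeff T α i := by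
  induction k with
  | zero => simp [upperFactorial]
  | succ k ih =>
    have h := powerCoeff_add_one (α := α + k) hT (by positivity) i
    have hk := hne k
    have hk' : α + i + 2 + k ≠ 0 := by positivity
    have e : (α + k + 1 - i) * (α + k + i + 2) = (α - i + 1 + k) * (α + i + 2 + k) := by ring
    rw [e, ← eq_div_iff (mul_ne_zero hk hk'), ih] at h
    rw [upperFactorial_succ, upperFactorial_succ, upperFactorial_succ, Nat.cast_succ, ← add_assoc,
      h]
    simp only [div_eq_mul_inv, mul_inv]
    ring

/-! ### The entries of `K^H` -/

theorem integrableOn_legendreHat_mul_fbmKernel {T H : ℝ} (hH : H ∈ Set.Ioo (0 : ℝ) 1)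
    (i j : ℕ) : IntegrableOn
      (fun p : ℝ × ℝ => legendreHat T i p.1 * legendreHat T j p.2 * fbmKernel H p.1 p.2)
      (Set.Icc 0 T ×ˢ Set.Icc 0 T) := by
  refine (integrableOn_fbmKernel hH).continuousOn_mul (Continuous.continuousOn ?_)
    (isCompact_Icc.prod isCompact_Icc)
  exact ((continuous_legendreHat T i).comp continuous_fst).mul
    ((continuous_legendreHat T j).comp continuous_snd)

theorem setIntegral_legendreHat_mul_fbmKernel {T H : ℝ} (hH : H ∈ Set.Ioo (0 : ℝ) 1)
    {t : ℝ} (ht : t ∈ Set.Ioc 0 T) (j : ℕ) :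
    ∫ τ in Set.Ioc 0 T, legendreHat T j τ * fbmKernel H t τ =
      fbmConst H * Real.Gamma (3 / 2 - H) * Real.sqrt ((2 * j + 1) / T) *
        ∑ k ∈ range (j + 1), legendreCoeff j k * upperFactorial (3 / 2 - H) k /
          (T ^ k * (H + 1 / 2 + k) * (k.factorial : ℝ)) * t ^ (H + 1 / 2 + k) := by
  have e : ∀ τ : ℝ, legendreHat T j τ * fbmKernel H t τ = Real.sqrt ((2 * j + 1) / T) *
      ∑ k ∈ range (j + 1), legendreCoeff j k / T ^ k * (τ ^ k * fbmKernel H t τ) := by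
    intro τ
    rw [legendreHat, mul_assoc, sum_mul]
    congr 1
    exact sum_congr rfl fun m _ => by ring
  simp_rw [e]
  rw [integral_const_mul, integral_finsetSum _
    fun k _ => (integrableOn_pow_mul_fbmKernel hH ht.1 k).const_mul _, mul_comm (fbmConst H * _),
    mul_assoc, mul_sum (range (j + 1)) _ (fbmConst H * _)]
  congr 1
  refine sum_congr rfl fun k _ => ?_
  rw [integral_const_mul, setIntegral_pow_mul_fbmKernel hH ht]
  simp only [div_eq_mul_inv, mul_inv]
  ring

theorem fbmMatrix_eq_sum {T H : ℝ} (hH : H ∈ Set.Ioo (0 : ℝ) 1) (i j : ℕ) :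
    fbmMatrix T H i j = fbmConst H * Real.Gamma (3 / 2 - H) * Real.sqrt ((2 * j + 1) / T) *
      ∑ k ∈ range (j + 1), legendreCoeff j k * upperFactorial (3 / 2 - H) k /
        (T ^ k * (H + 1 / 2 + k) * (k.factorial : ℝ)) * powerCoeff T (H + 1 / 2 + k) i := by
  have hint := integrableOn_legendreHat_mul_fbmKernel (T := T) hH i j
  rw [IntegrableOn, restrict_Icc_prod_Icc] at hint
  rw [fbmMatrix, restrict_Icc_prod_Icc, integral_prod _ hint]
  have e : ∀ t ∈ Set.Ioc 0 T,
      ∫ τ in Set.Ioc 0 T, legendreHat T i t * legendreHat T j τ * fbmKernel H t τ =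
      fbmConst H * Real.Gamma (3 / 2 - H) * Real.sqrt ((2 * j + 1) / T) *
        ∑ k ∈ range (j + 1), legendreCoeff j k * upperFactorial (3 / 2 - H) k /
          (T ^ k * (H + 1 / 2 + k) * (k.factorial : ℝ)) *
            (t ^ (H + 1 / 2 + k) * legendreHat T i t) := by
    intro t ht
    simp_rw [mul_assoc (legendreHat T i t)]
    rw [integral_const_mul, setIntegral_legendreHat_mul_fbmKernel hH ht, mul_left_comm, mul_sum]
    congr 1
    exact sum_congr rfl fun k _ => by ring
  have hα : ∀ k : ℕ, 0 < H + 1 / 2 + k := fun k => by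
    linarith [hH.1, (k.cast_nonneg : (0 : ℝ) ≤ k)]
  rw [setIntegral_congr_fun measurableSet_Ioc e, integral_const_mul, integral_finsetSum]
  · congr 1
    refine sum_congr rfl fun k _ => ?_
    rw [integral_const_mul, powerCoeff, integral_Icc_eq_integral_Ioc]
  · intro k _
    exact ((integrableOn_rpow_mul_legendreHat (hα k) T i).mono_set
      Set.Ioc_subset_Icc_self).const_mul _

theorem choose_mul_choose_succ (j k : ℕ) (h : k < j) :
    ((j + (k + 1)).choose j : ℝ) * (j.choose (k + 1)) * (k + 1) ^ 2 =
      (j + k).choose j * j.choose k * ((j - k) * (j + k + 1)) := by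
  have e1 := Nat.choose_succ_right_eq j k
  have e2 := Nat.choose_mul_succ_eq (j + k) j
  rw [Nat.add_assoc, show j + (k + 1) - j = k + 1 by omega] at e2
  have e1' : (j.choose (k + 1) : ℝ) * (k + 1) = j.choose k * (j - k) := by
    rw [← Nat.cast_sub h.le]
    exact_mod_cast e1
  have e2' : ((j + k).choose j : ℝ) * (j + (k + 1)) = (j + (k + 1)).choose j * (k + 1) := by
    exact_mod_cast e2
  linear_combination ((j + (k + 1)).choose j : ℝ) * (k + 1) * e1' -
    (j.choose k : ℝ) * (j - k) * e2'

theorem fbmProd_eq (H : ℝ) (i : ℕ) {j k : ℕ} (hk : k ≤ j) :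
    fbmProd H i j k = (j + k).choose j * j.choose k * upperFactorial (1 / 2 - H) k / k.factorial *
      (upperFactorial (H + 1 / 2 + 1) k ^ 2 /
        (upperFactorial (H + 1 / 2 - i + 1) k * upperFactorial (H + 1 / 2 + i + 2) k)) := by
  induction k with
  | zero => simp [fbmProd, upperFactorial]
  | succ k ih =>
    have hc := choose_mul_choose_succ j k hk
    have hc' : ((j + (k + 1)).choose j : ℝ) * (j.choose (k + 1)) =
      (j + k).choose j * j.choose k * ((j - k) * (j + k + 1)) / (k + 1) ^ 2 := by
      rw [eq_div_iff (by positivity), hc]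
    have h2 : H + 1 / 2 - i + (k + 1) = H + 1 / 2 - i + 1 + k := by ring
    have h3 : H + 1 / 2 + i + (k + 1) + 1 = H + 1 / 2 + i + 2 + k := by ring
    rw [fbmProd, ih (by omega), hc', Nat.factorial_succ, h2, h3]
    simp only [upperFactorial_succ]
    push_cast
    -- Inversion is multiplicative even at 0, so the denominators containing H + 1/2 - i need not be
    -- nonzero.
    simp only [div_eq_mul_inv, mul_inv, mul_pow, ← inv_pow]
    ring

/-- A zero would make H + 1/2 an integer in (1/2, 3/2), hence 1. -/
theorem add_half_sub_add_one_add_ne_zero {H : ℝ} (hH : H ∈ Set.Ioo (0 : ℝ) 1) (hH' : H ≠ 1 / 2)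
    (i n : ℕ) : H + 1 / 2 - i + 1 + n ≠ 0 := by
  intro h
  have hz : H + 1 / 2 = ((i - 1 - n : ℤ) : ℝ) := by push_cast; linarith
  have h1 : (0 : ℝ) < ((i - 1 - n : ℤ) : ℝ) := by linarith [hH.1]
  have h2 : ((i - 1 - n : ℤ) : ℝ) < 2 := by linarith [hH.2]
  have h1' : 0 < (i - 1 - n : ℤ) := by exact_mod_cast h1
  have h2' : (i - 1 - n : ℤ) < 2 := by exact_mod_cast h2
  have h3 : (i - 1 - n : ℤ) = 1 := by omega
  rw [h3] at hz
  exact hH' (by push_cast at hz; linarith)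

theorem fbmMatrix_eq_mul_sum_fbmProd {T H : ℝ} (hT : 0 < T) (hH : H ∈ Set.Ioo (0 : ℝ) 1)
    (hH' : H ≠ 1 / 2) (i j : ℕ) :
    fbmMatrix T H i j = fbmConst H * Real.Gamma (1 / 2 - H) * Real.sqrt ((2 * j + 1) / T) *
      powerCoeff T (H + 1 / 2) i *
        ∑ k ∈ range (j + 1), (-1) ^ (j - k) * ((1 / 2 - H + k) / (H + 1 / 2 + k)) *
          fbmProd H i j k := by
  have hne := add_half_sub_add_one_add_ne_zero hH hH' i
  have hG : Real.Gamma (3 / 2 - H) = (1 / 2 - H) * Real.Gamma (1 / 2 - H) := by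
    rw [← Real.Gamma_add_one (sub_ne_zero.2 hH'.symm)]
    congr 1
    ring
  rw [fbmMatrix_eq_sum hH, hG, mul_sum, mul_sum]
  refine sum_congr rfl fun k hk => ?_
  have hk : k ≤ j := Nat.lt_succ_iff.1 (mem_range.1 hk)
  -- The factor 1/2 - H released by the Gamma function turns (3/2 - H)ₖ into (1/2 - H)ₖ (1/2 - H +
  -- k): the first goes into Π, the second is the numerator beside it.
  have hu := upperFactorial_add_one_mul (1 / 2 - H) k
  rw [show 1 / 2 - H + 1 = 3 / 2 - H by ring] at hu
  have hTk : T ^ k * (T ^ k)⁻¹ = 1 := mul_inv_cancel₀ (by positivity)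
  rw [powerCoeff_add_natCast hT (by linarith [hH.1]) i hne k, fbmProd_eq H i hk,
    legendreCoeff, Nat.choose_symm hk]
  calc
    _ = T ^ k * (T ^ k)⁻¹ * (fbmConst H * Real.Gamma (1 / 2 - H) * Real.sqrt ((2 * j + 1) / T) *
        powerCoeff T (H + 1 / 2) i * (-1) ^ (j - k) * (j + k).choose j * j.choose k *
        (upperFactorial (3 / 2 - H) k * (1 / 2 - H)) / (H + 1 / 2 + k) / k.factorial *
        (upperFactorial (H + 1 / 2 + 1) k ^ 2 /
          (upperFactorial (H + 1 / 2 - i + 1) k * upperFactorial (H + 1 / 2 + i + 2) k))) := by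
      simp only [div_eq_mul_inv, mul_inv]
      ring
    _ = _ := by
      rw [hu, hTk]
      ring

theorem theorem1 (T H : ℝ) (hT : 0 < T) (hH : H ∈ Set.Ioo (0 : ℝ) 1) :
    -- the integrals that define the entries of `K^H` converge
    (∀ i j : ℕ, IntegrableOn
      (fun p : ℝ × ℝ => legendreHat T i p.1 * legendreHat T j p.2 * fbmKernel H p.1 p.2)
      (Set.Icc 0 T ×ˢ Set.Icc 0 T)) ∧
    -- the columns of `K^H`
    (∀ j : ℕ, (fbmMatrix T H).col j =
      (fbmConst H * Real.Gamma (3 / 2 - H) * Real.sqrt ((2 * j + 1) / T)) •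
        ∑ k ∈ range (j + 1),
          (legendreCoeff j k * upperFactorial (3 / 2 - H) k /
            (T ^ k * (H + 1 / 2 + k) * (k.factorial : ℝ))) • powerCoeff T (H + 1 / 2 + k)) ∧
    -- the elements of the columns `F^α` that occur: explicit values and the recurrence in the index
    (∀ i k : ℕ, ∀ α : ℝ, α = H + 1 / 2 + k →
      IntegrableOn (fun t : ℝ => t ^ α * legendreHat T i t) (Set.Icc 0 T) ∧
      powerCoeff T α i = Real.sqrt ((2 * i + 1) / T) *
        ∑ m ∈ range (i + 1), legendreCoeff i m * (T ^ (α + 1) / (α + m + 1)) ∧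
      powerCoeff T α i = T ^ α * Real.sqrt T *
        (Real.sqrt (2 * i + 1) * lowerFactorial α i / upperFactorial (α + 1) (i + 1)) ∧
      powerCoeff T α (i + 1) = Real.sqrt ((2 * i + 3) / (2 * i + 1)) *
        ((α - i) / (α + i + 2)) * powerCoeff T α i) ∧
    (H ≠ 1 / 2 →
      -- the recurrence in the degree for `F^(H + 1/2 + k)`
      (∀ i k : ℕ, powerCoeff T (H + 1 / 2 + k) i =
        T ^ k * upperFactorial (H + 1 / 2 + 1) k ^ 2 /
          (upperFactorial (H + 1 / 2 - i + 1) k * upperFactorial (H + 1 / 2 + i + 2) k) *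
          powerCoeff T (H + 1 / 2) i) ∧
      -- the entries of `K^H` in expanded form
      (∀ i j : ℕ, fbmMatrix T H i j =
        fbmConst H * Real.Gamma (1 / 2 - H) * Real.sqrt ((2 * j + 1) / T) *
          powerCoeff T (H + 1 / 2) i *
          ∑ k ∈ range (j + 1), (-1) ^ (j - k) * ((1 / 2 - H + k) / (H + 1 / 2 + k)) *
            fbmProd H i j k)) := by
  have hα : ∀ k : ℕ, 0 < H + 1 / 2 + k := fun k => by
    linarith [hH.1, (k.cast_nonneg : (0 : ℝ) ≤ k)]
  refine ⟨integrableOn_legendreHat_mul_fbmKernel hH, fun j => ?_, ?_, fun hH' => ⟨fun i k => ?_,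
    fbmMatrix_eq_mul_sum_fbmProd hT hH hH'⟩⟩
  · ext i
    simp only [Matrix.col_apply, Pi.smul_apply, Finset.sum_apply, smul_eq_mul]
    exact fbmMatrix_eq_sum hH i j
  · rintro i k α rfl
    exact ⟨integrableOn_rpow_mul_legendreHat (hα k) T i, powerCoeff_eq_sum hT (hα k) i,
      powerCoeff_eq_div hT (hα k) i, powerCoeff_succ hT (hα k) i⟩
  · exact powerCoeff_add_natCast hT (by linarith [hH.1]) i
      (add_half_sub_add_one_add_ne_zero hH hH' i) k
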